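/- Let $\mathbb{F}_q$ be a finite field with $q$ elements and $T$ an indeterminate. For $M=\sum_{n} a_nT^n\in\mathbb{F}_q[T]$ and $u\in\overline{\mathbb{F}_q(T)}$ let $u_q^M=\sum_n a_n(\phi_q+\mu_T)^n(u)$ be the Carlitz action, where $(\phi_q+\mu_T)(u)=u^q+Tu$. Let $\Lambda_{q,M}=\{u\in\overline{\mathbb{F}_q(T)} : u_q^M=0\}$, an $\mathbb{F}_q[T]$-module under this action, and let $\mathbb{T}_q=\bigcup_{M\neq 0}\Lambda_{q,M}$. Let $\mathfrak{P}$ be a place of $\overline{\mathbb{F}_q(T)}$ above the infinite place $\mathfrak{p}_\infty$ of $\mathbb{F}_q(T)$. Let $\mathbb{S}_q$ be the completion of $\mathbb{T}_q$ at $\mathfrak{P}$ (its closure in the completion of $\overline{\mathbb{F}_q(T)}$ at $\mathfrak{P}$), let $V_q=(\mathbb{F}_q(T))_\infty(\mathbb{S}_q)$ be the field generated over the completion $(\mathbb{F}_q(T))_\infty$ by $\mathbb{S}_q$, and write $\mathfrak{P}$ also for the induced place of $V_q$. Then the place $\mathfrak{P}$ of $V_q$ is discrete; let $v_\mathfrak{P}$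 be its normalized valuation (with value group $\mathbb{Z}$). For every $M\in\mathbb{F}_q[T]$ there is a natural number $K$, depending only on $q$ and $M$ (in particular not on $\mathfrak{P}$ or $u$), such that the following holds for every such $\mathfrak{P}$. Let $u=v_0\in\mathbb{T}_q$ be a generator of $\Lambda_{q,M}$. Then there is a sequence $(v_{-k})_{k\ge 1}$ in $\mathbb{T}_q$ such that 1. $v_{-k}\in\Lambda_{q,T^kM}$ for every $k\ge1$; 2. $(\phi_q+\mu_T)(v_{-k})=v_{-k+1}$ for every $k\ge1$; 3. for every choice of coefficients $a_{-k}\in\mathbb{F}_q$ $(k\ge1)$, the series $\sum_{k=1}^\infty a_{-k}v_{-k}$ converges in $V_q$ at $\mathfrak{P}$; 4. $v_{-k}$ is a generator of $\Lambda_{q,T^kM}$ for every $k\ge1$; 5. the valuations $v_\mathfrak{P}(v_{-k})$ are, for $k\ge K$, strictly increasing with slope $q-1$: there is $c\in\mathbb{Z}$ with $v_\mathfrak{P}(v_{-k})=c+(q-1)k$ for all $k\ge K$. -/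

import Mathlib

open Polynomial Filter Topology WithZero

noncomputable section

namespace QUnitCircle

/-- An algebraic closure of the rational function field `𝔽_q(T)`, where `F = 𝔽_q`. -/
abbrev Kbar (F : Type*) [Field F] : Type _ := AlgebraicClosure (RatFunc F)

/-- The operator `φ_q + μ_T : u ↦ u ^ q + T * u`, where `q` is the number of elements of `F`. -/
def carlitzT (F : Type*) [Field F] [Fintype F] : Module.End F (Kbar F) :=
  (FiniteField.frobeniusAlgHom F (Kbar F)).toLinearMap +
    LinearMap.mulLeft F (algebraMap (RatFunc F) (Kbar F) RatFunc.X)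

theorem carlitzT_apply {F : Type*} [Field F] [Fintype F] (u : Kbar F) :
    carlitzT F u = u ^ Fintype.card F + algebraMap (RatFunc F) (Kbar F) RatFunc.X * u := by
  simp [carlitzT]

/-- The Carlitz action `M ·_q u = ∑ aₙ (φ_q + μ_T)ⁿ(u)` of `M = ∑ aₙ Tⁿ ∈ 𝔽_q[T]`. -/
def carlitz {F : Type*} [Field F] [Fintype F] (M : F[X]) (u : Kbar F) : Kbar F :=
  aeval (carlitzT F) M u

theorem carlitz_eq_sum {F : Type*} [Field F] [Fintype F] (M : F[X]) (u : Kbar F) :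
    carlitz M u = M.sum fun n a => a • (carlitzT F)^[n] u := by
  simp [carlitz, aeval_endomorphism, Module.End.pow_apply]

/-- The Carlitz torsion module `Λ_{q,M}`. -/
def torsion {F : Type*} [Field F] [Fintype F] (M : F[X]) : Set (Kbar F) :=
  {u | carlitz M u = 0}

/-- `u` generates `Λ_{q,M}` as an `𝔽_q[T]`-module under the Carlitz action. -/
def IsGenerator {F : Type*} [Field F] [Fintype F] (M : F[X]) (u : Kbar F) : Prop :=
  u ∈ torsion M ∧ ∀ w ∈ torsion M, ∃ A : F[X], carlitz A u = w

/-- The set `𝕋_q` of all Carlitz torsion points. -/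
def Tq (F : Type*) [Field F] [Fintype F] : Set (Kbar F) :=
  {u | ∃ M : F[X], M ≠ 0 ∧ u ∈ torsion M}

open Classical in
/-- A place of the algebraic closure above the infinite place of `𝔽_q(T)`, given by its
valuation ring. -/
structure InftyPlace (F : Type*) [Field F] where
  /-- The valuation ring of the place. -/
  ring : ValuationSubring (Kbar F)
  above : ring.comap (algebraMap (RatFunc F) (Kbar F)) =
    (RatFunc.inftyValuation F).valuationSubring

/-- The completion at `𝔓` of the algebraic closure. -/
abbrev InftyPlace.Completion {F : Type*} [Field F] (𝔓 : InftyPlace F) : Type _ :=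
  𝔓.ring.valuation.Completion

/-- The embedding of the algebraic closure in its completion at `𝔓`. -/
def InftyPlace.emb {F : Type*} [Field F] (𝔓 : InftyPlace F) : Kbar F →+* 𝔓.Completion :=
  (UniformSpace.Completion.coeRingHom (α := WithVal 𝔓.ring.valuation)).comp
    (WithVal.equiv 𝔓.ring.valuation).symm.toRingHom

/-- `(𝔽_q(T))_∞`, realized as the closure of `𝔽_q(T)` in the completion at `𝔓`. -/
def Kinfty {F : Type*} [Field F] (𝔓 : InftyPlace F) : Set 𝔓.Completion :=
  closure (Set.range fun x : RatFunc F => 𝔓.emb (algebraMap (RatFunc F) (Kbar F) x))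

/-- The `q`-unit circle `𝕊_q`: the completion of `𝕋_q` at `𝔓`. -/
def Sq {F : Type*} [Field F] [Fintype F] (𝔓 : InftyPlace F) : Set 𝔓.Completion :=
  closure (𝔓.emb '' Tq F)

/-- The field `V_q = (𝔽_q(T))_∞(𝕊_q)`. -/
def Vq {F : Type*} [Field F] [Fintype F] (𝔓 : InftyPlace F) : Subfield 𝔓.Completion :=
  Subfield.closure (Kinfty 𝔓 ∪ Sq 𝔓)

/-- A torsion point, as an element of `V_q`. -/
def toVq {F : Type*} [Field F] [Fintype F] (𝔓 : InftyPlace F) (u : Tq F) : Vq 𝔓 :=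
  ⟨𝔓.emb u, Subfield.subset_closure (Or.inr (subset_closure ⟨u, u.2, rfl⟩))⟩

/-- `ν` is the normalized discrete valuation of `V_q` at `𝔓`, written multiplicatively
(`ν x = exp (-v_𝔓(x))`): it belongs to the place of `V_q` induced by `𝔓`, and its value group is
all of `ℤ`. Such a `ν` is unique. -/
def IsNormalizedValuation {F : Type*} [Field F] [Fintype F] (𝔓 : InftyPlace F)
    (ν : Valuation (Vq 𝔓) ℤᵐ⁰) : Prop :=
  ν.IsEquiv ((Valued.v : Valuation 𝔓.Completion 𝔓.ring.ValueGroup).comap (Vq 𝔓).subtype) ∧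
    Function.Surjective ν

end QUnitCircle

end

open QUnitCircle

noncomputable section

namespace QUnitCircle

/-! ### Carlitz torsion, generators and preimages under `carlitzT`. -/

section Algebra

/-! Everything is measured against `ξ = xi F`, where `ξ^(q-1) = -T` and `v ξ > 1`. At size `v ξ` the
terms `u^q` and `T u` balance: below it `carlitzT` multiplies sizes by `v T = (v ξ)^(q-1)`, above it
sizes grow strictly, so torsion points have size at most `v ξ` (`valuation_le_of_mem_Tq`). By
`prod_div_xi_sub`, a point of such size has a preimage smaller than `ξ`
(`exists_carlitzT_eq_of_valuation_le`); iterating this choice gives slope `q-1`.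

Discreteness: solving `C_T(u) = u^q + T u` for the linear term approximates torsion points by
elements of `𝔽_q(ξ)` (`exists_valuation_sub_mul_pow_le`). Hence `V_q` lies in the closure of
`𝔽_q(ξ)`, whose nonzero elements have the size of a power of `ξ`.

Only the first preimage needs care to be a generator; after it `T` divides the modulus and every
preimage is one. Hence `K = 1` works. -/

theorem algebraMap_X_ne_zero {F : Type*} [Field F] :
    algebraMap (RatFunc F) (Kbar F) RatFunc.X ≠ 0 := by
  simp [RatFunc.X_ne_zero]

variable {F : Type*} [Field F] [Fintype F]

theorem carlitz_mul (A B : F[X]) (u : Kbar F) : carlitz (A * B) u = carlitz A (carlitz B u) := by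
  simp [carlitz, Module.End.mul_apply]

theorem carlitz_add_left (A B : F[X]) (u : Kbar F) :
    carlitz (A + B) u = carlitz A u + carlitz B u := by
  simp [carlitz]

theorem carlitz_one (u : Kbar F) : carlitz (1 : F[X]) u = u := by
  simp [carlitz]

theorem carlitz_zero_left (u : Kbar F) : carlitz (0 : F[X]) u = 0 := by
  simp [carlitz]

theorem carlitz_C (c : F) (u : Kbar F) : carlitz (C c) u = c • u := by
  simp [carlitz]

theorem carlitz_X (u : Kbar F) : carlitz (X : F[X]) u = carlitzT F u := by
  simp [carlitz]

theorem carlitz_add (A : F[X]) (u w : Kbar F) : carlitz A (u + w) = carlitz A u + carlitz A w :=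
  map_add (aeval (carlitzT F) A) u w

theorem carlitz_zero (A : F[X]) : carlitz A (0 : Kbar F) = 0 :=
  map_zero (aeval (carlitzT F) A)

theorem carlitz_comm (A B : F[X]) (u : Kbar F) :
    carlitz A (carlitz B u) = carlitz B (carlitz A u) := by
  rw [← carlitz_mul, ← carlitz_mul, mul_comm]

theorem carlitz_mem_Tq (A : F[X]) {u : Kbar F} (hu : u ∈ Tq F) : carlitz A u ∈ Tq F := by
  obtain ⟨M, hM, h⟩ := hu
  refine ⟨M, hM, ?_⟩
  rw [torsion, Set.mem_ofPred_eq, carlitz_comm, show carlitz M u = 0 from h, carlitz_zero]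

theorem carlitzT_mem_Tq {u : Kbar F} (hu : u ∈ Tq F) : carlitzT F u ∈ Tq F :=
  carlitz_X u ▸ carlitz_mem_Tq X hu

theorem smul_mem_Tq (c : F) {u : Kbar F} (hu : u ∈ Tq F) : c • u ∈ Tq F :=
  carlitz_C c u ▸ carlitz_mem_Tq (C c) hu

theorem zero_mem_Tq : (0 : Kbar F) ∈ Tq F := ⟨1, one_ne_zero, carlitz_zero 1⟩

theorem add_mem_Tq {u w : Kbar F} (hu : u ∈ Tq F) (hw : w ∈ Tq F) : u + w ∈ Tq F := by
  obtain ⟨M, hM, h⟩ := hu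
  obtain ⟨N, hN, h'⟩ := hw
  refine ⟨M * N, mul_ne_zero hM hN, ?_⟩
  rw [torsion, Set.mem_ofPred_eq, carlitz_add, carlitz_mul, carlitz_comm, carlitz_mul,
    show carlitz M u = 0 from h, show carlitz N w = 0 from h', carlitz_zero, carlitz_zero, add_zero]

theorem sub_mem_Tq {u w : Kbar F} (hu : u ∈ Tq F) (hw : w ∈ Tq F) : u - w ∈ Tq F := by
  have := add_mem_Tq hu (smul_mem_Tq (-1) hw)
  rwa [neg_smul, one_smul, ← sub_eq_add_neg] at this

theorem sum_mem_Tq {ι : Type*} (s : Finset ι) (f : ι → Kbar F) (hf : ∀ i ∈ s, f i ∈ Tq F) :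
    ∑ i ∈ s, f i ∈ Tq F := by
  classical
  induction s using Finset.induction_on with
  | empty => simpa using zero_mem_Tq
  | insert a s ha ih =>
    rw [Finset.sum_insert ha]
    exact add_mem_Tq (hf a (by simp)) (ih fun i hi => hf i (by simp [hi]))

theorem exists_carlitzT_eq (w : Kbar F) : ∃ u, carlitzT F u = w := by
  have hq : 1 < Fintype.card F := Fintype.one_lt_card
  set t := algebraMap (RatFunc F) (Kbar F) RatFunc.X
  have hlt : (C t * X - C w).degree < (Fintype.card F : WithBot ℕ) := by
    refine lt_of_le_of_lt (degree_sub_le _ _) (max_lt ?_ ?_)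
    · exact (degree_C_mul_X_le t).trans_lt (mod_cast hq)
    · exact degree_C_le.trans_lt (mod_cast (by omega))
  have hdeg : (X ^ Fintype.card F + (C t * X - C w)).degree = (Fintype.card F : WithBot ℕ) := by
    rw [degree_add_eq_left_of_degree_lt (by rwa [degree_X_pow]), degree_X_pow]
  obtain ⟨u, hu⟩ := IsAlgClosed.exists_root (X ^ Fintype.card F + (C t * X - C w))
    (by rw [hdeg]; exact mod_cast (by omega))
  refine ⟨u, ?_⟩
  rw [carlitzT_apply]
  simp only [IsRoot, eval_add, eval_pow, eval_X, eval_sub, eval_mul, eval_C] at hu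
  linear_combination hu

variable (F) in
/-- A `(q - 1)`-st root of `-T`; it spans `Λ_{q,T}`. -/
def xi : Kbar F :=
  (IsAlgClosed.exists_pow_nat_eq (-algebraMap (RatFunc F) (Kbar F) RatFunc.X)
    (Nat.sub_pos_of_lt (Fintype.one_lt_card (α := F)))).choose

theorem xi_pow :
    xi F ^ (Fintype.card F - 1) = -algebraMap (RatFunc F) (Kbar F) RatFunc.X :=
  (IsAlgClosed.exists_pow_nat_eq (-algebraMap (RatFunc F) (Kbar F) RatFunc.X)
    (Nat.sub_pos_of_lt (Fintype.one_lt_card (α := F)))).choose_spec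

theorem xi_pow_card :
    xi F ^ Fintype.card F = -algebraMap (RatFunc F) (Kbar F) RatFunc.X * xi F := by
  rw [← xi_pow, ← pow_succ, Nat.sub_add_cancel Fintype.card_pos]

theorem xi_ne_zero : xi F ≠ 0 := by
  intro h
  have := xi_pow (F := F)
  rw [h, zero_pow (Nat.sub_pos_of_lt (Fintype.one_lt_card (α := F))).ne'] at this
  exact algebraMap_X_ne_zero (neg_eq_zero.mp this.symm)

theorem carlitzT_xi : carlitzT F (xi F) = 0 := by
  rw [carlitzT_apply, xi_pow_card]; ring

theorem xi_mem_Tq : xi F ∈ Tq F := ⟨X, X_ne_zero, (carlitz_X _).trans carlitzT_xi⟩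

theorem prod_sub_algebraMap (s : Kbar F) :
    ∏ c : F, (s - algebraMap F (Kbar F) c) = s ^ Fintype.card F - s := by
  have hm : (X ^ Fintype.card F - X : F[X]).Monic :=
    monic_X_pow_sub (by simpa using mod_cast Fintype.one_lt_card (α := F))
  have h := Polynomial.prod_multiset_X_sub_C_of_monic_of_roots_card_eq hm (by
    rw [FiniteField.roots_X_pow_card_sub_X,
      FiniteField.X_pow_card_sub_X_natDegree_eq F Fintype.one_lt_card]; rfl)
  rw [FiniteField.roots_X_pow_card_sub_X] at h
  change ∏ c : F, (X - C c) = _ at h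
  simpa only [map_prod, map_sub, map_pow, aeval_X, aeval_C] using congrArg (aeval s) h

/-- `∏ (u / ξ - c)` over `c ∈ 𝔽_q` is `(φ_q + μ_T)(u) / ξ ^ q`. -/
theorem prod_div_xi_sub (u : Kbar F) :
    ∏ c : F, (u / xi F - algebraMap F (Kbar F) c) = carlitzT F u / xi F ^ Fintype.card F := by
  have h0 := xi_ne_zero (F := F)
  rw [prod_sub_algebraMap, carlitzT_apply, eq_div_iff (pow_ne_zero _ h0), sub_mul, div_pow,
    div_mul_cancel₀ _ (pow_ne_zero _ h0), xi_pow_card]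
  field_simp
  ring

theorem eq_smul_xi_of_carlitzT_eq_zero {u : Kbar F} (hu : carlitzT F u = 0) :
    ∃ c : F, u = c • xi F := by
  have h := prod_div_xi_sub u
  rw [hu, zero_div, Finset.prod_eq_zero_iff] at h
  obtain ⟨c, -, hc⟩ := h
  refine ⟨c, ?_⟩
  rw [Algebra.smul_def, ← sub_eq_zero.mp hc, div_mul_cancel₀ _ xi_ne_zero]

theorem carlitzT_smul_xi (c : F) : carlitzT F (c • xi F) = 0 := by
  rw [map_smul, carlitzT_xi, smul_zero]

theorem carlitz_xi (A : F[X]) : carlitz A (xi F) = A.coeff 0 • xi F := by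
  nth_rw 1 [← divX_mul_X_add A]
  rw [carlitz_add_left, carlitz_mul, carlitz_X, carlitzT_xi, carlitz_zero, carlitz_C, zero_add]

/-- To generate `Λ_{q,TM}` it is enough to reach `ξ` and a generator of `Λ_{q,M}`. -/
theorem IsGenerator.of_carlitzT {M : F[X]} {u v : Kbar F} (hu : IsGenerator M u)
    (hv : carlitzT F v = u) {B : F[X]} {c : F} (hc : c ≠ 0) (hB : carlitz B v = c • xi F) :
    IsGenerator (X * M) v := by
  refine ⟨?_, fun w hw => ?_⟩
  · rw [torsion, Set.mem_ofPred_eq, mul_comm, carlitz_mul, carlitz_X, hv]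
    exact hu.1
  · have hw' : carlitzT F w ∈ torsion M := by
      rw [torsion, Set.mem_ofPred_eq, mul_comm, carlitz_mul, carlitz_X] at hw
      exact hw
    obtain ⟨A, hA⟩ := hu.2 _ hw'
    have h0 : carlitzT F (w - carlitz A v) = 0 := by
      rw [map_sub, ← hA, ← hv, ← carlitz_X (carlitz A v), carlitz_comm, carlitz_X, sub_self]
    obtain ⟨d, hd⟩ := eq_smul_xi_of_carlitzT_eq_zero h0
    -- The error `w - A·v` is `d ξ`, and `B` carries `v` to `c ξ`.
    refine ⟨A + C (d / c) * B, ?_⟩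
    rw [carlitz_add_left, carlitz_mul, hB, carlitz_C, smul_smul, div_mul_cancel₀ _ hc, ← hd]
    ring

/-- As `T ∣ M`, `ξ` already lies in `Λ_M`, so `u`, and through it any preimage, reaches `ξ`. -/
theorem IsGenerator.of_carlitzT_of_dvd {M : F[X]} {u v : Kbar F} (hu : IsGenerator M u)
    (hv : carlitzT F v = u) (hM : X ∣ M) : IsGenerator (X * M) v := by
  obtain ⟨N, rfl⟩ := hM
  obtain ⟨B, hB⟩ := hu.2 (xi F) (by
    rw [torsion, Set.mem_ofPred_eq, mul_comm, carlitz_mul, carlitz_X, carlitzT_xi, carlitz_zero])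
  refine hu.of_carlitzT hv (B := B * X) one_ne_zero ?_
  rw [carlitz_mul, carlitz_X, hv, hB, one_smul]

theorem IsGenerator.exists_carlitzT_eq {M : F[X]} {u : Kbar F} (hu : IsGenerator M u) :
    ∃ v, carlitzT F v = u ∧ IsGenerator (X * M) v := by
  by_cases hM : X ∣ M
  · obtain ⟨v, hv⟩ := QUnitCircle.exists_carlitzT_eq u
    exact ⟨v, hv, hu.of_carlitzT_of_dvd hv hM⟩
  · obtain ⟨a, b, hab⟩ := (EuclideanDomain.dvd_or_coprime X M irreducible_X).resolve_left hM
    -- With `aT ≡ 1` mod `M`, `a·u` is a preimage but stays in `Λ_M`. Adding `ξ` repairs this: `M`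
    -- kills `a·u` and scales `ξ` by the nonzero constant term of `M`.
    have hMu : carlitz M u = 0 := hu.1
    have hv : carlitzT F (carlitz a u + xi F) = u := by
      rw [map_add, carlitzT_xi, add_zero, ← carlitz_X, ← carlitz_mul, mul_comm,
        eq_sub_of_add_eq hab, sub_eq_add_neg, ← neg_mul, carlitz_add_left, carlitz_mul, hMu,
        carlitz_one, carlitz_zero, add_zero]
    refine ⟨_, hv, hu.of_carlitzT hv (B := M) (c := M.coeff 0) (fun h => hM (X_dvd_iff.mpr h)) ?_⟩
    rw [carlitz_add, carlitz_comm, hMu, carlitz_zero, zero_add, carlitz_xi]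

end Algebra
-- Rational functions inside subalgebras of the algebraic closure.
section RatFunc

variable {F : Type*} [Field F]

theorem algebraMap_algebraMap_eq_aeval (p : F[X]) :
    algebraMap (RatFunc F) (Kbar F) (algebraMap F[X] (RatFunc F) p) =
      aeval (algebraMap (RatFunc F) (Kbar F) RatFunc.X) p := by
  rw [aeval_algebraMap_apply, RatFunc.aeval_X_left_eq_algebraMap]

theorem aeval_mem_subalgebra {S : Subalgebra F (Kbar F)} {x : Kbar F} (hx : x ∈ S) (p : F[X]) :
    aeval x p ∈ S :=
  Algebra.adjoin_le (Set.singleton_subset_iff.mpr hx) (aeval_mem_adjoin_singleton F x)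

theorem algebraMap_ratFunc_mem {S : Subalgebra F (Kbar F)}
    (hX : algebraMap (RatFunc F) (Kbar F) RatFunc.X ∈ S) (hinv : ∀ p : F[X], p ≠ 0 →
      (aeval (algebraMap (RatFunc F) (Kbar F) RatFunc.X) p)⁻¹ ∈ S) (x : RatFunc F) :
    algebraMap (RatFunc F) (Kbar F) x ∈ S := by
  obtain ⟨p, q, hq, rfl⟩ := IsFractionRing.div_surjective (A := F[X]) x
  rw [map_div₀, algebraMap_algebraMap_eq_aeval, algebraMap_algebraMap_eq_aeval, div_eq_mul_inv]
  exact S.mul_mem (aeval_mem_subalgebra hX p)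
    (hinv q (nonZeroDivisors.ne_zero hq))

end RatFunc

/-! ### Size estimates for a valuation trivial on `F`, mostly with `v T > 1`. -/

section Valuation

variable {F : Type*} [Field F] {Γ : Type*} [LinearOrderedCommGroupWithZero Γ]
  {v : Valuation (Kbar F) Γ} [hv : v.IsTrivialOn F]

theorem valuation_smul_le (c : F) (u : Kbar F) : v (c • u) ≤ v u := by
  rw [Algebra.smul_def, map_mul]
  rcases eq_or_ne c 0 with rfl | hc
  · simp
  · rw [hv.eq_one c hc, one_mul]

/-- The elements of the algebraic closure are bounded by the powers of `T`. -/
theorem exists_valuation_le_pow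
    (hT : 1 < v (algebraMap (RatFunc F) (Kbar F) RatFunc.X)) (z : Kbar F) :
    ∃ n : ℕ, v z ≤ v (algebraMap (RatFunc F) (Kbar F) RatFunc.X) ^ n := by
  set t := algebraMap (RatFunc F) (Kbar F) RatFunc.X with ht
  let R : Subalgebra F (Kbar F) :=
    { carrier := {z | ∃ n : ℕ, v z ≤ v t ^ n}
      mul_mem' := by
        rintro a b ⟨m, hm⟩ ⟨n, hn⟩
        exact ⟨m + n, by rw [map_mul, pow_add]; exact mul_le_mul' hm hn⟩
      add_mem' := by
        rintro a b ⟨m, hm⟩ ⟨n, hn⟩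
        refine ⟨max m n, v.map_add_le ?_ ?_⟩
        · exact hm.trans (pow_le_pow_right₀ hT.le (le_max_left _ _))
        · exact hn.trans (pow_le_pow_right₀ hT.le (le_max_right _ _))
      algebraMap_mem' := fun c => ⟨0, by
        simpa [Algebra.algebraMap_eq_smul_one] using valuation_smul_le (v := v) c 1⟩ }
  -- `R` contains the valuation ring of `v`, so it is a valuation ring itself, hence integrally
  -- closed; containing `𝔽_q(T)`, it contains all algebraic elements.
  let A : ValuationSubring (Kbar F) :=
    { R.toSubring with
      mem_or_inv_mem' := fun x => by
        rcases le_total (v x) 1 with h | h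
        · exact Or.inl ⟨0, by simpa using h⟩
        · exact Or.inr ⟨0, by rw [map_inv₀, pow_zero]; exact inv_le_one_of_one_le₀ h⟩ }
  have hR : ∀ x : RatFunc F, algebraMap (RatFunc F) (Kbar F) x ∈ R := by
    refine algebraMap_ratFunc_mem ⟨1, by rw [pow_one]⟩ fun p hp => ⟨0, ?_⟩
    rw [map_inv₀, valuation_aeval_eq_valuation_X_pow_natDegree_of_one_lt_valuation_X _ hT hp,
      pow_zero]
    exact inv_le_one_of_one_le₀ (one_le_pow₀ hT.le)
  let f : RatFunc F →+* A := (algebraMap (RatFunc F) (Kbar F)).codRestrict A hR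
  have hz : IsIntegral A z := by
    obtain ⟨p, hp, hpz⟩ := (Algebra.IsAlgebraic.isAlgebraic (R := RatFunc F) z).isIntegral
    refine ⟨p.map f, hp.map f, ?_⟩
    rw [eval₂_map]
    exact hpz
  obtain ⟨y, hy⟩ := IsIntegrallyClosed.isIntegral_iff.mp hz
  have hmem : (y : Kbar F) ∈ R := y.2
  rw [show (y : Kbar F) = z from hy] at hmem
  exact hmem

variable [Fintype F]

omit hv in
theorem valuation_X_eq :
    v (algebraMap (RatFunc F) (Kbar F) RatFunc.X) = v (xi F) ^ (Fintype.card F - 1) := by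
  rw [← map_pow, xi_pow, Valuation.map_neg]

variable (hT : 1 < v (algebraMap (RatFunc F) (Kbar F) RatFunc.X))
include hT

omit hv in
theorem one_lt_valuation_xi : 1 < v (xi F) := by
  by_contra! h
  rw [valuation_X_eq] at hT
  exact absurd hT (pow_le_one₀ zero_le h).not_gt

omit hv in
theorem valuation_xi_le : v (xi F) ≤ v (algebraMap (RatFunc F) (Kbar F) RatFunc.X) := by
  rw [valuation_X_eq]
  exact le_self_pow₀ (one_lt_valuation_xi hT).le
    (Nat.sub_pos_of_lt (Fintype.one_lt_card (α := F))).ne'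

omit hT hv in
theorem valuation_carlitzT_of_lt {u : Kbar F} (hu : v u < v (xi F)) :
    v (carlitzT F u) = v (algebraMap (RatFunc F) (Kbar F) RatFunc.X) * v u := by
  rcases eq_or_ne u 0 with rfl | h0
  · simp
  have hq := Nat.sub_pos_of_lt (Fintype.one_lt_card (α := F))
  rw [carlitzT_apply, Valuation.map_add_eq_of_lt_right, map_mul]
  rw [map_mul, map_pow, valuation_X_eq, ← Nat.sub_add_cancel (Fintype.card_pos (α := F)), pow_succ,
    Nat.add_sub_cancel]
  have := zero_lt_iff.mpr ((Valuation.ne_zero_iff v).mpr h0)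
  gcongr

omit hT hv in
theorem valuation_carlitzT_of_gt {u : Kbar F} (hu : v (xi F) < v u) :
    v (carlitzT F u) = v u ^ Fintype.card F := by
  have hq := Nat.sub_pos_of_lt (Fintype.one_lt_card (α := F))
  rw [carlitzT_apply, Valuation.map_add_eq_of_lt_left, map_pow]
  rw [map_mul, map_pow, valuation_X_eq, ← Nat.sub_add_cancel (Fintype.card_pos (α := F)), pow_succ,
    Nat.add_sub_cancel]
  have := zero_le.trans_lt hu
  have := zero_le (a := v (xi F))
  gcongr

/-- Write `N = N'T + c`. Beyond `ξ`, `carlitzT` strictly increases size, so by induction on the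
degree `N'·C_T(u)` dominates `c u`. -/
theorem le_valuation_carlitz {N : F[X]} (hN : N ≠ 0) {u : Kbar F} (hu : v (xi F) < v u) :
    v u ≤ v (carlitz N u) := by
  induction hn : N.natDegree using Nat.strong_induction_on generalizing N u with
  | _ n ih =>
    subst hn
    by_cases hd : divX N = 0
    · have hN' := divX_mul_X_add N
      rw [hd, zero_mul, zero_add] at hN'
      have hc : N.coeff 0 ≠ 0 := fun h => hN (by rw [← hN', h, C_0])
      rw [← hN', carlitz_C, Algebra.smul_def, map_mul, hv.eq_one _ hc, one_mul]
    · have hlt : v u < v (carlitzT F u) := by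
        rw [valuation_carlitzT_of_gt hu]
        exact lt_self_pow₀ ((one_lt_valuation_xi hT).trans hu) Fintype.one_lt_card
      have hdeg : (divX N).natDegree < N.natDegree := by
        rw [natDegree_divX_eq_natDegree_tsub_one]
        refine Nat.sub_lt (Nat.pos_of_ne_zero fun h => hd ?_) one_pos
        exact divX_eq_zero_iff.mpr (eq_C_of_natDegree_eq_zero h)
      have h1 := ih _ hdeg hd (hu.trans hlt) rfl
      rw [show carlitz N u = carlitz (divX N * X + C (N.coeff 0)) u by rw [divX_mul_X_add],
        carlitz_add_left, carlitz_mul, carlitz_X, carlitz_C, Valuation.map_add_eq_of_lt_left]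
      · exact hlt.le.trans h1
      · exact (valuation_smul_le _ _).trans_lt (hlt.trans_le h1)

theorem valuation_le_of_mem_Tq {u : Kbar F} (hu : u ∈ Tq F) : v u ≤ v (xi F) := by
  obtain ⟨N, hN, h⟩ := hu
  by_contra! hlt
  have := le_valuation_carlitz hT hN hlt
  rw [show carlitz N u = 0 from h, map_zero] at this
  exact absurd hlt (this.trans zero_le).not_gt

/-- `Λ_0` is the whole field and contains `T^2`, which is too large to be a multiple of a torsion
point. -/
theorem IsGenerator.ne_zero {M : F[X]} {u : Kbar F} (hu : IsGenerator M u) (hu' : u ∈ Tq F) :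
    M ≠ 0 := by
  rintro rfl
  obtain ⟨A, hA⟩ := hu.2 (algebraMap (RatFunc F) (Kbar F) RatFunc.X ^ 2) (carlitz_zero_left _)
  have h := valuation_le_of_mem_Tq hT (hA ▸ carlitz_mem_Tq A hu')
  rw [map_pow] at h
  exact absurd (lt_self_pow₀ hT one_lt_two) (h.trans (valuation_xi_le hT)).not_gt

-- The product of the `u/ξ - c` is `C_T(u)/ξ^q`, of size below 1, so some factor is below 1.
omit hv in
theorem exists_valuation_sub_smul_xi_lt {u : Kbar F} (hu : v (carlitzT F u) ≤ v (xi F)) :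
    ∃ c : F, v (u - c • xi F) < v (xi F) := by
  have hxi := one_lt_valuation_xi hT
  have hpos : 0 < v (xi F) := zero_lt_one.trans hxi
  have hprod : ∏ c : F, v (u / xi F - algebraMap F (Kbar F) c) < 1 := by
    rw [← map_prod, prod_div_xi_sub, map_div₀, map_pow, div_lt_one₀ (pow_pos hpos _)]
    exact hu.trans_lt (lt_self_pow₀ hxi Fintype.one_lt_card)
  obtain ⟨c, hc⟩ : ∃ c : F, v (u / xi F - algebraMap F (Kbar F) c) < 1 := by
    by_contra! h
    exact absurd hprod (Finset.prod_induction _ (fun x => 1 ≤ x) (fun a b ha hb =>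
      one_le_mul ha hb) le_rfl fun c _ => h c).not_gt
  refine ⟨c, ?_⟩
  have : u - c • xi F = (u / xi F - algebraMap F (Kbar F) c) * xi F := by
    rw [sub_mul, div_mul_cancel₀ _ xi_ne_zero, Algebra.smul_def]
  rw [this, map_mul]
  exact mul_lt_of_lt_one_left hpos hc

omit hv in
theorem exists_carlitzT_eq_of_valuation_le {w : Kbar F} (hw : v w ≤ v (xi F)) :
    ∃ u, carlitzT F u = w ∧
      v w = v (algebraMap (RatFunc F) (Kbar F) RatFunc.X) * v u := by
  obtain ⟨u, rfl⟩ := exists_carlitzT_eq w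
  obtain ⟨c, hc⟩ := exists_valuation_sub_smul_xi_lt hT hw
  have h : carlitzT F (u - c • xi F) = carlitzT F u := by rw [map_sub, carlitzT_smul_xi, sub_zero]
  exact ⟨_, h, h ▸ valuation_carlitzT_of_lt hc⟩

omit hv hT in
theorem algebraMap_ratFunc_mem_adjoin_xi (x : RatFunc F) :
    algebraMap (RatFunc F) (Kbar F) x ∈ IntermediateField.adjoin F {xi F} := by
  have hX : algebraMap (RatFunc F) (Kbar F) RatFunc.X ∈ IntermediateField.adjoin F {xi F} := by
    rw [← neg_neg (algebraMap _ _ _), ← xi_pow]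
    exact neg_mem (pow_mem (IntermediateField.mem_adjoin_simple_self F _) _)
  exact algebraMap_ratFunc_mem (S := (IntermediateField.adjoin F {xi F}).toSubalgebra) hX
    (fun p _ => (IntermediateField.adjoin F {xi F}).inv_mem (aeval_mem_subalgebra hX p)) x

theorem exists_valuation_eq_zpow {l : Kbar F} (hl : l ∈ IntermediateField.adjoin F {xi F})
    (h0 : l ≠ 0) : ∃ n : ℤ, v l = v (xi F) ^ n := by
  have hxi := one_lt_valuation_xi hT
  obtain ⟨r, s, rfl⟩ := (IntermediateField.mem_adjoin_simple_iff F l).mp hl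
  have hr : r ≠ 0 := by rintro rfl; simp at h0
  have hs : s ≠ 0 := by rintro rfl; simp at h0
  refine ⟨r.natDegree - s.natDegree, ?_⟩
  rw [map_div₀, valuation_aeval_eq_valuation_X_pow_natDegree_of_one_lt_valuation_X _ hxi hr,
    valuation_aeval_eq_valuation_X_pow_natDegree_of_one_lt_valuation_X _ hxi hs,
    zpow_sub₀ (zero_lt_one.trans hxi).ne', zpow_natCast, zpow_natCast]

/-- Torsion points are limits of elements of `𝔽_q(ξ)`. -/
theorem exists_valuation_sub_mul_pow_le {u : Kbar F} (hu : u ∈ Tq F) (n : ℕ) :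
    ∃ l ∈ IntermediateField.adjoin F {xi F}, v (u - l) * v (xi F) ^ n ≤ 1 := by
  have hxi := one_lt_valuation_xi hT
  set t := algebraMap (RatFunc F) (Kbar F) RatFunc.X with ht
  have htpos : 0 < v t := zero_lt_one.trans hT
  have hsmul : ∀ c : F, c • xi F ∈ IntermediateField.adjoin F {xi F} := fun c =>
    IntermediateField.smul_mem _ (IntermediateField.mem_adjoin_simple_self F _)
  induction n generalizing u with
  | zero =>
    obtain ⟨c, hc⟩ :=
      exists_valuation_sub_smul_xi_lt hT (valuation_le_of_mem_Tq hT (carlitzT_mem_Tq hu))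
    refine ⟨c • xi F, hsmul c, ?_⟩
    -- For `w = u - cξ`: `v T * v w = v (C_T w) ≤ v ξ ≤ v T`, hence `v w ≤ 1`.
    have h1 := valuation_le_of_mem_Tq hT
      (carlitzT_mem_Tq (sub_mem_Tq hu (smul_mem_Tq c xi_mem_Tq)))
    rw [valuation_carlitzT_of_lt hc] at h1
    rw [pow_zero, mul_one]
    by_contra! h
    exact absurd (h1.trans (valuation_xi_le hT)) (lt_mul_of_one_lt_right htpos h).not_ge
  | succ n ih =>
    obtain ⟨c, hc⟩ :=
      exists_valuation_sub_smul_xi_lt hT (valuation_le_of_mem_Tq hT (carlitzT_mem_Tq hu))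
    obtain ⟨l, hl, hlu⟩ := ih (carlitzT_mem_Tq hu)
    obtain ⟨l', hl', hlu'⟩ := ih (sub_mem_Tq hu (smul_mem_Tq c xi_mem_Tq))
    -- With `w = u - cξ`, `w = (C_T(u) - w^q)/T`; approximate `C_T(u)` by `l` and `w` by `l'`.
    -- Frobenius is additive and loses no precision; dividing by `T` gains at least one factor `v
    -- ξ`.
    refine ⟨(l - l' ^ Fintype.card F) / t + c • xi F,
      add_mem (div_mem (sub_mem hl (pow_mem hl' _)) (algebraMap_ratFunc_mem_adjoin_xi _))
        (hsmul c), ?_⟩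
    have hfrob : (u - c • xi F - l') ^ Fintype.card F =
        (u - c • xi F) ^ Fintype.card F - l' ^ Fintype.card F :=
      map_sub (FiniteField.frobeniusAlgHom F (Kbar F)) (u - c • xi F) l'
    have hT0 : carlitzT F u = (u - c • xi F) ^ Fintype.card F + t * (u - c • xi F) := by
      rw [← carlitzT_apply, map_sub, carlitzT_smul_xi, sub_zero]
    have key : (u - ((l - l' ^ Fintype.card F) / t + c • xi F)) * t =
        (carlitzT F u - l) - (u - c • xi F - l') ^ Fintype.card F := by
      rw [hfrob, hT0, sub_mul, add_mul, div_mul_cancel₀ _ algebraMap_X_ne_zero]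
      ring
    have h1 : v (u - ((l - l' ^ Fintype.card F) / t + c • xi F)) * v t * v (xi F) ^ n ≤ 1 := by
      rw [← map_mul, key, ← map_pow, ← map_mul, sub_mul]
      refine v.map_sub_le (by rwa [map_mul, map_pow]) ?_
      rw [map_mul, map_pow, map_pow]
      refine le_trans ?_ (pow_le_one₀ (n := Fintype.card F) zero_le hlu')
      rw [mul_pow]
      refine mul_le_mul_right ?_ _
      rw [← pow_mul]
      exact pow_le_pow_right₀ hxi.le (Nat.le_mul_of_pos_right _ Fintype.card_pos)
    refine le_trans ?_ h1
    rw [pow_succ', mul_assoc (v _)]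
    gcongr
    exact valuation_xi_le hT

end Valuation
-- Normalizing a valuation with cyclic value group.
/-- A valuation whose values are `0` and the powers of one of them, `g > 1`, is equivalent to a
normalized discrete valuation. -/
theorem exists_isEquiv_withZero_int {K Γ : Type*} [Field K] [LinearOrderedCommGroupWithZero Γ]
    (w : Valuation K Γ) {g : Γ} (hg : 1 < g) (h : ∀ x, x ≠ 0 → ∃ n : ℤ, w x = g ^ n)
    {x₁ : K} (hx₁ : w x₁ = g) :
    ∃ ν : Valuation K ℤᵐ⁰, ν.IsEquiv w ∧ Function.Surjective ν ∧
      ∀ x (n : ℤ), w x = g ^ n → ν x = exp n := by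
  have hg0 : g ≠ 0 := (zero_lt_one.trans hg).ne'
  -- `e` sends `exp n` to `g^n`; the normalized valuation is `w` followed by the inverse of `e` on
  -- its image.
  let e : ℤᵐ⁰ →*₀ Γ :=
    WithZero.lift' ((Units.coeHom Γ).comp (zpowersHom Γˣ (Units.mk0 g hg0)))
  have he : ∀ n : ℤ, e (exp n) = g ^ n := fun n => by
    change WithZero.lift' _ ((Multiplicative.ofAdd n : Multiplicative ℤ) : ℤᵐ⁰) = _
    rw [WithZero.lift'_coe]
    simp
  have hmono : StrictMono e := by
    intro a b hab
    induction b using WithZero.expRecOn with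
    | zero => exact absurd hab zero_le.not_gt
    | exp b =>
      induction a using WithZero.expRecOn with
      | zero => rw [map_zero, he]; exact zpow_pos (zero_lt_one.trans hg) b
      | exp a => rw [he, he]; exact zpow_lt_zpow_right₀ hg (exp_lt_exp.mp hab)
  have hex : ∀ x, ∃ m, e m = w x := fun x => by
    rcases eq_or_ne x 0 with rfl | hx
    · exact ⟨0, by simp⟩
    · obtain ⟨n, hn⟩ := h x hx
      exact ⟨exp n, by rw [he, hn]⟩
  choose f hf using hex
  let ν : Valuation K ℤᵐ⁰ :=
    { toFun := f
      map_zero' := hmono.injective (by simp [hf])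
      map_one' := hmono.injective (by simp [hf])
      map_mul' := fun x y => hmono.injective (by simp [hf])
      map_add_le_max' := fun x y => by
        rw [← hmono.le_iff_le, hmono.monotone.map_max, hf, hf, hf]
        exact w.map_add x y }
  have hν : ∀ x (n : ℤ), w x = g ^ n → ν x = exp n := fun x n hx =>
    hmono.injective (by rw [he, ← hx]; exact hf x)
  refine ⟨ν, fun x y => ?_, fun m => ?_, hν⟩
  · rw [← hf x, ← hf y, hmono.le_iff_le]; rfl
  · induction m using WithZero.expRecOn with
    | zero => exact ⟨0, map_zero ν⟩
    | exp n => exact ⟨x₁ ^ n, hν _ n (by rw [map_zpow₀, hx₁])⟩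

theorem nonarchimedeanRing_of_valued (R Γ : Type*) [Ring R] [LinearOrderedCommGroupWithZero Γ]
    [Valued R Γ] : NonarchimedeanRing R :=
  (Valued.toUniformSpace_eq R Γ).symm ▸ Valued.v.subgroups_basis.nonarchimedean

/-! ### Places above infinity, discreteness of `V_q`, and convergence. -/

section Place

variable {F : Type*} [Field F] (𝔓 : InftyPlace F)

theorem InftyPlace.valuation_algebraMap_le_one_iff (x : RatFunc F) :
    𝔓.ring.valuation (algebraMap (RatFunc F) (Kbar F) x) ≤ 1 ↔
      x = 0 ∨ x.intDegree ≤ 0 := by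
  classical
  rw [ValuationSubring.valuation_le_one_iff, ← ValuationSubring.mem_comap, 𝔓.above,
    Valuation.mem_valuationSubring_iff, RatFunc.inftyValuation_apply]
  rcases eq_or_ne x 0 with rfl | hx
  · simp [RatFunc.inftyValuationDef]
  · rw [RatFunc.inftyValuation_of_nonzero _ hx, ← exp_zero, exp_le_exp]
    simp [hx]

instance InftyPlace.isTrivialOn : 𝔓.ring.valuation.IsTrivialOn F where
  eq_one c hc := by
    have h : ∀ d : F, 𝔓.ring.valuation (algebraMap F (Kbar F) d) ≤ 1 := fun d => by
      rw [IsScalarTower.algebraMap_apply F (RatFunc F), 𝔓.valuation_algebraMap_le_one_iff,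
        RatFunc.algebraMap_eq_C, RatFunc.intDegree_C]
      exact Or.inr le_rfl
    refine le_antisymm (h c) ?_
    have h' := h c⁻¹
    rw [map_inv₀, map_inv₀] at h'
    exact (inv_le_one₀ (zero_lt_iff.mpr (by simpa using hc))).mp h'

theorem InftyPlace.one_lt_valuation_X :
    1 < 𝔓.ring.valuation (algebraMap (RatFunc F) (Kbar F) RatFunc.X) := by
  rw [← not_le, 𝔓.valuation_algebraMap_le_one_iff, RatFunc.intDegree_X]
  simp [RatFunc.X_ne_zero]

theorem InftyPlace.valued_emb (u : Kbar F) :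
    (Valued.v (𝔓.emb u) : 𝔓.ring.ValueGroup) = 𝔓.ring.valuation u :=
  Valued.valuedCompletion_apply _

variable [Fintype F]

theorem InftyPlace.one_lt_valuation_xi : 1 < 𝔓.ring.valuation (xi F) :=
  QUnitCircle.one_lt_valuation_xi 𝔓.one_lt_valuation_X

/-- Every radius is the size of an algebraic element, and inverses of these are bounded by powers of
`T`; so powers of `ξ` suffice to test neighbourhoods. -/
theorem InftyPlace.exists_ball_subset {x : 𝔓.Completion} {s : Set 𝔓.Completion} (hs : s ∈ 𝓝 x) :
    ∃ n : ℕ, ∀ y : 𝔓.Completion,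
      Valued.v (y - x) * 𝔓.ring.valuation (xi F) ^ n ≤ 1 → y ∈ s := by
  have hxi := 𝔓.one_lt_valuation_xi
  have hT := 𝔓.one_lt_valuation_X
  obtain ⟨γ, hγ⟩ := Valued.mem_nhds.mp hs
  obtain ⟨z, hz⟩ := 𝔓.ring.valuation_surjective
    (MonoidWithZeroHom.ValueGroup₀.embedding γ.1)
  have hz0 : 𝔓.ring.valuation z ≠ 0 := by rw [hz]; simp
  obtain ⟨n, hn⟩ := exists_valuation_le_pow hT z⁻¹
  -- The factor `q-1` turns powers of `ξ` into powers of `T`; `n + 1` makes the bound strict.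
  refine ⟨(Fintype.card F - 1) * (n + 1), fun y hy => hγ ?_⟩
  rw [Set.mem_ofPred_eq, Valuation.restrict_lt_iff_lt_embedding, ← hz]
  rw [pow_mul, ← valuation_X_eq] at hy
  have h1 : 𝔓.ring.valuation z⁻¹ <
      𝔓.ring.valuation (algebraMap (RatFunc F) (Kbar F) RatFunc.X) ^ (n + 1) :=
    hn.trans_lt (pow_lt_pow_right₀ hT (Nat.lt_succ_self n))
  by_contra! hcon
  have hpos := zero_lt_iff.mpr hz0
  have h2 : (1 : 𝔓.ring.ValueGroup) = 𝔓.ring.valuation z * 𝔓.ring.valuation z⁻¹ := by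
    rw [map_inv₀, mul_inv_cancel₀ hz0]
  refine absurd hy (not_le_of_gt ?_)
  calc (1 : 𝔓.ring.ValueGroup) = 𝔓.ring.valuation z * 𝔓.ring.valuation z⁻¹ := h2
    _ < 𝔓.ring.valuation z *
        𝔓.ring.valuation (algebraMap (RatFunc F) (Kbar F) RatFunc.X) ^ (n + 1) :=
      mul_lt_mul_of_pos_left h1 hpos
    _ ≤ _ := mul_le_mul_left hcon _

/-- The closure of `𝔽_q(ξ)` in the completion at `𝔓`. -/
def InftyPlace.closureXi : Subfield 𝔓.Completion :=
  ((IntermediateField.adjoin F {xi F}).toSubfield.map 𝔓.emb).topologicalClosure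

theorem InftyPlace.isClosed_closureXi : IsClosed (𝔓.closureXi : Set 𝔓.Completion) :=
  Subfield.isClosed_topologicalClosure _

theorem InftyPlace.emb_mem_closureXi {l : Kbar F} (hl : l ∈ IntermediateField.adjoin F {xi F}) :
    𝔓.emb l ∈ 𝔓.closureXi :=
  Subfield.le_topologicalClosure _ ⟨l, hl, rfl⟩

theorem InftyPlace.emb_mem_closureXi_of_mem_Tq {u : Kbar F} (hu : u ∈ Tq F) :
    𝔓.emb u ∈ 𝔓.closureXi := by
  rw [← SetLike.mem_coe, ← 𝔓.isClosed_closureXi.closure_eq, mem_closure_iff_nhds]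
  intro s hs
  obtain ⟨n, hn⟩ := 𝔓.exists_ball_subset hs
  obtain ⟨l, hl, h⟩ := exists_valuation_sub_mul_pow_le 𝔓.one_lt_valuation_X hu n
  refine ⟨𝔓.emb l, hn _ ?_, 𝔓.emb_mem_closureXi hl⟩
  rwa [← map_sub, 𝔓.valued_emb, Valuation.map_sub_swap]

theorem InftyPlace.Vq_le_closureXi : Vq 𝔓 ≤ 𝔓.closureXi := by
  refine Subfield.closure_le.mpr (Set.union_subset ?_ ?_)
  · refine closure_minimal ?_ 𝔓.isClosed_closureXi
    rintro _ ⟨x, rfl⟩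
    exact 𝔓.emb_mem_closureXi (algebraMap_ratFunc_mem_adjoin_xi x)
  · refine closure_minimal ?_ 𝔓.isClosed_closureXi
    rintro _ ⟨u, hu, rfl⟩
    exact 𝔓.emb_mem_closureXi_of_mem_Tq hu

/-- The valuation is locally constant away from 0, so `x` has the size of a nearby element of
`𝔽_q(ξ)`. -/
theorem InftyPlace.exists_valued_eq_zpow {x : 𝔓.Completion} (hx : x ∈ 𝔓.closureXi) (h0 : x ≠ 0) :
    ∃ n : ℤ, Valued.v x = 𝔓.ring.valuation (xi F) ^ n := by
  have hv : (Valued.v x : 𝔓.ring.ValueGroup) ≠ 0 := (Valuation.ne_zero_iff _).mpr h0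
  obtain ⟨_, hy, l, hl, rfl⟩ := mem_closure_iff_nhds.mp hx _ (Valued.locally_const hv)
  rw [Set.mem_ofPred_eq, 𝔓.valued_emb] at hy
  rw [← hy]
  refine exists_valuation_eq_zpow 𝔓.one_lt_valuation_X hl ?_
  rintro rfl
  exact hv (by rw [← hy, map_zero])

theorem InftyPlace.exists_isNormalizedValuation :
    ∃ ν : Valuation (Vq 𝔓) ℤᵐ⁰, IsNormalizedValuation 𝔓 ν ∧
      ∀ (u : Tq F) (n : ℤ), 𝔓.ring.valuation u = 𝔓.ring.valuation (xi F) ^ n →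
        ν (toVq 𝔓 u) = exp n := by
  obtain ⟨ν, h1, h2, h3⟩ := exists_isEquiv_withZero_int
    ((Valued.v : Valuation 𝔓.Completion 𝔓.ring.ValueGroup).comap (Vq 𝔓).subtype)
    𝔓.one_lt_valuation_xi
    (fun x hx => 𝔓.exists_valued_eq_zpow (𝔓.Vq_le_closureXi x.2) (by simpa using hx))
    (x₁ := toVq 𝔓 ⟨xi F, xi_mem_Tq⟩) (𝔓.valued_emb _)
  exact ⟨ν, ⟨h1, h2⟩, fun u n hu => h3 _ n ((𝔓.valued_emb _).trans hu)⟩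

theorem InftyPlace.exists_valuation_eq_zpow_of_mem_Tq {u : Kbar F} (hu : u ∈ Tq F) (h0 : u ≠ 0) :
    ∃ n : ℤ, 𝔓.ring.valuation u = 𝔓.ring.valuation (xi F) ^ n := by
  rw [← 𝔓.valued_emb]
  exact 𝔓.exists_valued_eq_zpow (𝔓.emb_mem_closureXi_of_mem_Tq hu) (by simpa using h0)

/-- A series of torsion points whose valuations tend to infinity converges in `𝕊_q`. -/
theorem InftyPlace.exists_tendsto_sum {s : ℕ → Kbar F} (hs : ∀ k, 1 ≤ k → s k ∈ Tq F)
    (h : ∀ n : ℕ, ∀ᶠ k in atTop, 𝔓.ring.valuation (s k) * 𝔓.ring.valuation (xi F) ^ n ≤ 1) :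
    ∃ S ∈ Vq 𝔓, Tendsto (fun n : ℕ => ∑ k ∈ Finset.Icc 1 n, 𝔓.emb (s k)) atTop (𝓝 S) := by
  have hc : CauchySeq fun n : ℕ => ∑ k ∈ Finset.Icc 1 n, 𝔓.emb (s k) := by
    have := nonarchimedeanRing_of_valued 𝔓.Completion 𝔓.ring.ValueGroup
    apply NonarchimedeanAddGroup.cauchySeq_of_tendsto_sub_nhds_zero
    have h0 : Tendsto (fun k => 𝔓.emb (s k)) atTop (𝓝 0) := by
      intro U hU
      obtain ⟨n, hn⟩ := 𝔓.exists_ball_subset hU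
      rw [mem_map]
      filter_upwards [h n] with k hk
      exact hn _ (by rwa [sub_zero, 𝔓.valued_emb])
    refine (h0.comp (tendsto_add_atTop_nat 1)).congr fun n => ?_
    rw [Finset.sum_Icc_succ_top (by omega), add_sub_cancel_left]
    rfl
  obtain ⟨S, hS⟩ := cauchySeq_tendsto_of_complete hc
  refine ⟨S, Subfield.subset_closure (Or.inr ?_), hS⟩
  refine mem_closure_of_tendsto hS (Eventually.of_forall fun n => ?_)
  rw [← map_sum]
  exact ⟨_, sum_mem_Tq _ _ fun k hk => hs k (Finset.mem_Icc.mp hk).1, rfl⟩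

/-- The successive preimages of a generator under `φ_q + μ_T`, chosen small from the second on. -/
theorem InftyPlace.exists_generator_seq {M : F[X]} {u : Kbar F} (hu : IsGenerator M u)
    (hu' : u ∈ Tq F) :
    ∃ s : ℕ → Kbar F, s 0 = u ∧ (∀ k, carlitzT F (s (k + 1)) = s k) ∧
      (∀ k, IsGenerator (X ^ k * M) (s k)) ∧ (∀ k, s k ∈ Tq F) ∧
      ∃ m : ℤ, ∀ k, 𝔓.ring.valuation (s (k + 1)) =
        𝔓.ring.valuation (xi F) ^ (m - ((Fintype.card F : ℤ) - 1) * k) := by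
  have hT := 𝔓.one_lt_valuation_X
  have hM := hu.ne_zero hT hu'
  -- This preimage is chosen to be a generator, so its size exponent `m` is not prescribed; later
  -- ones are chosen small.
  obtain ⟨w, hw, hwg⟩ := hu.exists_carlitzT_eq
  have hw' : w ∈ Tq F := ⟨_, mul_ne_zero X_ne_zero hM, hwg.1⟩
  have hw0 : w ≠ 0 := by
    rintro rfl
    obtain ⟨A, hA⟩ := hwg.2 (xi F) (by
      rw [torsion, Set.mem_ofPred_eq, mul_comm, carlitz_mul, carlitz_X, carlitzT_xi, carlitz_zero])
    exact xi_ne_zero (hA.symm.trans (carlitz_zero A))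
  obtain ⟨m, hm⟩ := 𝔓.exists_valuation_eq_zpow_of_mem_Tq hw' hw0
  have hstep : ∀ x : Tq F, ∃ y : Tq F, carlitzT F y = x ∧ 𝔓.ring.valuation (x : Kbar F) =
      𝔓.ring.valuation (algebraMap (RatFunc F) (Kbar F) RatFunc.X) *
        𝔓.ring.valuation (y : Kbar F) := by
    rintro ⟨x, hx⟩
    obtain ⟨y, hy, h⟩ := exists_carlitzT_eq_of_valuation_le hT (valuation_le_of_mem_Tq hT hx)
    obtain ⟨N, hN, hNx⟩ := hx
    refine ⟨⟨y, N * X, mul_ne_zero hN X_ne_zero, ?_⟩, hy, h⟩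
    rw [torsion, Set.mem_ofPred_eq, carlitz_mul, carlitz_X, hy]
    exact hNx
  choose g hg hgv using hstep
  let t : ℕ → Tq F := fun k => g^[k] ⟨w, hw'⟩
  have ht : ∀ k, t (k + 1) = g (t k) := fun k => Function.iterate_succ_apply' _ _ _
  have htg : ∀ k, IsGenerator (X ^ (k + 1) * M) (t k : Kbar F) := fun k => by
    induction k with
    | zero => simpa [t] using hwg
    | succ k ih =>
      rw [pow_succ', mul_assoc, ht]
      exact ih.of_carlitzT_of_dvd (hg _) (Dvd.dvd.mul_right (dvd_pow_self _ k.succ_ne_zero) _)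
  have htv : ∀ k : ℕ, 𝔓.ring.valuation (t k : Kbar F) =
      𝔓.ring.valuation (xi F) ^ (m - ((Fintype.card F : ℤ) - 1) * k) := fun k => by
    induction k with
    | zero => simpa [t] using hm
    | succ k ih =>
      have hxi0 : 𝔓.ring.valuation (xi F) ≠ 0 := (zero_lt_one.trans 𝔓.one_lt_valuation_xi).ne'
      have h := hgv (t k)
      rw [← ht, ih, valuation_X_eq, ← zpow_natCast, Nat.cast_sub Fintype.card_pos,
        mul_comm (_ ^ _), ← div_eq_iff (zpow_ne_zero _ hxi0), ← zpow_sub₀ hxi0] at h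
      rw [← h]
      refine congrArg _ ?_
      push_cast
      ring
  refine ⟨fun k => Nat.casesOn k u fun k => (t k : Kbar F), rfl, ?_, ?_, ?_, m, htv⟩
  · rintro (_ | k)
    · exact hw
    · change carlitzT F (t (k + 1)) = t k
      rw [ht, hg]
  · rintro (_ | k)
    · simpa using hu
    · exact htg k
  · rintro (_ | k)
    · exact hu'
    · exact (t k).2

end Place
end QUnitCircle

end

/-! ### The main theorem. -/

open QUnitCircle
theorem mainTheorem11 (F : Type*) [Field F] [Fintype F] (M : F[X]) :
    ∃ K : ℕ, ∀ 𝔓 : InftyPlace F, ∃ ν : Valuation (Vq 𝔓) ℤᵐ⁰, IsNormalizedValuation 𝔓 ν ∧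
      ∀ u : Tq F, IsGenerator M (u : Kbar F) →
        ∃ v : ℕ → Tq F, v 0 = u ∧
          (∀ k, 1 ≤ k → (v k : Kbar F) ∈ torsion (X ^ k * M)) ∧
          (∀ k, 1 ≤ k → carlitzT F (v k) = v (k - 1)) ∧
          (∀ a : ℕ → F, ∃ S ∈ Vq 𝔓, Tendsto
            (fun n : ℕ => ∑ k ∈ Finset.Icc 1 n, 𝔓.emb (a k • (v k : Kbar F))) atTop (𝓝 S)) ∧
          (∀ k, 1 ≤ k → IsGenerator (X ^ k * M) (v k : Kbar F)) ∧
          ∃ c : ℤ, ∀ k, K ≤ k →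
            ν (toVq 𝔓 (v k)) = exp (-(c + ((Fintype.card F : ℤ) - 1) * (k : ℤ))) := by
  refine ⟨1, fun 𝔓 => ?_⟩
  obtain ⟨ν, hν, hν'⟩ := 𝔓.exists_isNormalizedValuation
  refine ⟨ν, hν, fun u hu => ?_⟩
  obtain ⟨s, hs0, hsT, hsg, hst, m, hsv⟩ := 𝔓.exists_generator_seq hu u.2
  -- The shift in `c` arises because `m` is the exponent at index 1, not 0.
  refine ⟨fun k => ⟨s k, hst k⟩, Subtype.ext hs0, fun k _ => (hsg k).1, ?_, fun a => ?_,
    fun k _ => hsg k, -m - ((Fintype.card F : ℤ) - 1), fun k hk => hν' _ _ ?_⟩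
  · rintro (_ | k) hk
    · exact absurd hk (by omega)
    · exact hsT k
  · refine 𝔓.exists_tendsto_sum (fun k _ => smul_mem_Tq (a k) (hst k)) fun n => ?_
    -- With `k = j + 1` this gives `m + n ≤ j ≤ (q-1)j`, since `q ≥ 2`.
    filter_upwards [eventually_ge_atTop ((m + n).toNat + 1)] with k hk
    obtain ⟨j, rfl⟩ := Nat.exists_eq_add_of_le' (le_add_self.trans hk)
    have hxi := 𝔓.one_lt_valuation_xi
    refine (mul_le_mul_left (valuation_smul_le _ _) _).trans ?_
    rw [hsv, ← zpow_natCast, ← zpow_add₀ (zero_lt_one.trans hxi).ne']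
    refine zpow_le_one_of_nonpos₀ hxi.le ?_
    have hq : (2 : ℤ) ≤ Fintype.card F := mod_cast Fintype.one_lt_card (α := F)
    have hj : m + n ≤ j := by omega
    nlinarith [mul_nonneg (sub_nonneg.mpr hq) (Int.natCast_nonneg j)]
  · obtain ⟨j, rfl⟩ := Nat.exists_eq_add_of_le' hk
    change 𝔓.ring.valuation (s (j + 1)) = _
    rw [hsv]
    congr 1
    push_cast
    ring
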